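/- **Definitions.** An *extensional $\mathbf{BC^{\pm}I}$-algebra* is a set $\mathcal A$ with a binary application (written by juxtaposition, left associative) and elements $B, C^+, C^-, I$ such that, writing $a\circ b=B\,a\,b$, for all $a,b,c\in\mathcal A$ (signs $\pm,\mp$ are linked, $\star$ is either sign): $$B\,a\,b\,c=a(b\,c),\quad C^\star a\,b\,c=a\,c\,b,\quad I\,a=a,\quad C^+a\,b=C^-a\,b,\quad B\,I=I,\quad C^\star B\,I=B\,I,$$ $$(C^\star B\,B)\circ(B\circ B)=(B\,B)\circ B,\quad C^\pm\circ C^\mp=B(B\,I),\quad (C^\star B\,C^\pm)\circ(B\circ B)=(B\,C^\pm)\circ(B\circ B),$$ $$(B\,C^\pm)\circ(C^\pm\circ(B\,C^\pm))=C^\pm\circ((B\,C^\pm)\circ C^\pm),\quad (B\,B)\circ C^\pm=C^\pm\circ((B\,C^\pm)\circ B).$$ It is *balanced* if it is equipped with elements $\theta^+,\theta^-$ such that $$(B\,\theta^\pm)\circ B=(C^\star B\,\theta^\pm)\circ B,\quad \theta^\pm\circ\theta^\mp=B\,I,\quad C^\star\theta^\star a=C^\star I\,a,\quad B\circ\theta^\pm=\theta^\pm\circ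 C^\pm\circ\theta^\pm\circ C^\pm\circ B.$$ (The operation $\circ$ is associative.) Put $a^\bullet=C^+I\,a$, $a^0=I$ and $a^{n+1}=a\circ a^n$. An element $a$ *has arity* $m\to n$ if $a^\bullet\circ B^{m+1}=(B\,a)\circ B^n$. The *internal PRO* $\mathcal I_{\mathcal A}$ is the strict monoidal category with objects the natural numbers, with $\mathcal I_{\mathcal A}(m,n)=\{a\in\mathcal A\mid a \text{ has arity } m\to n\}$, with composite of $a\colon l\to m$ followed by $b\colon m\to n$ equal to $a\circ b$, with identities $I$, with tensor product $m+n$ on objects and unit $0$, and, for $a\colon m\to n$, with $l+a=B^l\,a$ and $a+l=a$. A *ribbon category* is a braided monoidal category with braid $\sigma$ and a twist (a natural isomorphism $\theta_X\colon X\to X$ with $\theta_{X\otimes Y}=\sigma_{X,Y};(\theta_Y\otimes\theta_X);\sigma_{Y,X}$) in which every object $X$ has a chosen dual $X^*$, with unit $I\to X\otimes X^*$ and counit $X^*\otimes X\to I$ satisfying the snake equations, such that $(\theta_X)^*=\theta_{X^*}$. **Proposition.** Let $\mathcal A$ be a balanced extensional $\mathbf{BC^\pm I}$-algebra with elements $\alpha,\beta$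 satisfying $$\alpha^\bullet\circ B=(B\,\alpha)\circ B^2,\quad \beta^\bullet\circ B^3=B\,\beta,\quad \alpha\circ(B\,\beta)=B\,I,\quad (B\,\alpha)\circ\beta=B\,I,\quad \alpha\circ\theta^\pm=\alpha\circ(B\,\theta^\pm)$$ (that is, $\mathcal A$ is a ribbon extensional $\mathbf{BC^\pm I}$-algebra). Then $\mathcal I_{\mathcal A}$ is a ribbon category, with the following structure. * The braid is the family $\sigma_{m,n}\colon m+n\to n+m$ given by $\sigma_{0,1}=I$, $\sigma_{m+1,1}=(B\,\sigma_{m,1})\circ C^+$, $\sigma_{m,0}=I$, $\sigma_{m,n+1}=\sigma_{m,1}\circ(B\,\sigma_{m,n})$; in particular $\sigma_{1,1}=C^+$ and $\sigma_{1,1}^{-1}=C^-$. * The twist is the family $\theta_m\colon m\to m$ given by $\theta_0=I$, $\theta_{m+1}=\theta^+\circ\sigma_{1,m}\circ\theta_m\circ\sigma_{m,1}$; in particular $\theta_1=\theta^+$ and $\theta_1^{-1}=\theta^-$. * Every object is its own dual, $n^*=n$. The unit $\alpha_n\colon 0\to n+n$ and the counit $\beta_n\colon n+n\to 0$ are given by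 $\alpha_0=\beta_0=I$, $\alpha_{n+1}=\alpha\circ(B\,\alpha_n)$ and $\beta_{n+1}=(B^n\,\beta)\circ\beta_n$; in particular the object $1$ has unit $\alpha\colon 0\to2$ and counit $\beta\colon2\to0$. -/

import Mathlib

open CategoryTheory MonoidalCategory

universe u v

/-! ### Combinatory algebras with braids, twists and duality -/

/-- The two signs `+` and `-` decorating the constants of a braided combinatory algebra. -/
inductive Sgn
  | pos
  | neg

/-- The opposite sign. -/
def Sgn.flip : Sgn → Sgn
  | pos => neg
  | neg => pos

/-- An applicative structure together with constants `B`, `C⁺ = C pos`, `C⁻ = C neg` and `I`. -/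
class BCIStructure (A : Type u) where
  /-- application -/
  app : A → A → A
  /-- the combinator `B` -/
  B : A
  /-- the combinators `C⁺` and `C⁻` -/
  C : Sgn → A
  /-- the combinator `I` -/
  I : A

namespace BCIStructure

/-- Application, associating to the left. -/
infixl:90 " ⬝ " => BCIStructure.app

/-- The composite `a ∘ b = B a b` (in diagrammatic order when read in the internal PRO). -/
def comp {A : Type u} [BCIStructure A] (a b : A) : A := B ⬝ a ⬝ b

/-- Composition of elements of a combinatory algebra. -/
infixr:80 " ⊚ " => BCIStructure.comp

/-- Iterated composition: `a⁰ = I` and `aⁿ⁺¹ = a ∘ aⁿ`. -/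
def compPow {A : Type u} [BCIStructure A] (a : A) : ℕ → A
  | 0 => I
  | n + 1 => a ⊚ compPow a n

/-- The element `a• = C⁺ I a`, which satisfies `a• b = b a`. -/
def bullet {A : Type u} [BCIStructure A] (a : A) : A := C Sgn.pos ⬝ I ⬝ a

/-- `a` is of arity `m → n` when `a• ∘ Bᵐ⁺¹ = (B a) ∘ Bⁿ`. -/
def HasArity {A : Type u} [BCIStructure A] (m n : ℕ) (a : A) : Prop :=
  bullet a ⊚ compPow B (m + 1) = (B ⬝ a) ⊚ compPow B n

end BCIStructure

open BCIStructure

/-- Extensional `BC±I`-algebras. In each axiom the sign `s` is linked (`±`, with `∓` its flip),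
while the sign `t` is an arbitrary choice (`⋆`). -/
class ExtBCIAlgebra (A : Type u) extends BCIStructure A where
  app_B : ∀ a b c : A, B ⬝ a ⬝ b ⬝ c = a ⬝ (b ⬝ c)
  app_C : ∀ (t : Sgn) (a b c : A), C t ⬝ a ⬝ b ⬝ c = a ⬝ c ⬝ b
  app_I : ∀ a : A, I ⬝ a = a
  app_C_two : ∀ a b : A, C Sgn.pos ⬝ a ⬝ b = C Sgn.neg ⬝ a ⬝ b
  ax_lambda : (B : A) ⬝ I = I
  ax_rho : ∀ t : Sgn, (C t : A) ⬝ B ⬝ I = B ⬝ I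
  ax_alpha : ∀ t : Sgn, ((C t : A) ⬝ B ⬝ B) ⊚ (B ⊚ B) = (B ⬝ B) ⊚ B
  cox_one : ∀ s : Sgn, (C s : A) ⊚ C s.flip = B ⬝ (B ⬝ I)
  cox_two : ∀ t s : Sgn, ((C t : A) ⬝ B ⬝ C s) ⊚ (B ⊚ B) = (B ⬝ C s) ⊚ (B ⊚ B)
  cox_three : ∀ s : Sgn,
    ((B : A) ⬝ C s) ⊚ (C s ⊚ (B ⬝ C s)) = C s ⊚ ((B ⬝ C s) ⊚ C s)
  ax_bc : ∀ s : Sgn, ((B : A) ⬝ B) ⊚ C s = C s ⊚ ((B ⬝ C s) ⊚ B)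

/-- Balanced extensional `BC±I`-algebras, with `θ⁺ = θ pos` and `θ⁻ = θ neg`. -/
class BalancedExtBCIAlgebra (A : Type u) extends ExtBCIAlgebra A where
  /-- the elements `θ⁺` and `θ⁻` -/
  θ : Sgn → A
  theta_one : ∀ t s : Sgn, (B ⬝ θ s) ⊚ B = (C t ⬝ B ⬝ θ s) ⊚ B
  theta_two : ∀ s : Sgn, θ s ⊚ θ s.flip = B ⬝ I
  theta_three : ∀ (t s : Sgn) (a : A), C t ⬝ θ s ⬝ a = C t ⬝ I ⬝ a
  theta_four : ∀ s : Sgn, B ⊚ θ s = θ s ⊚ C s ⊚ θ s ⊚ C s ⊚ B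

/-- The pair `α`, `β` is a duality: `α` has arity `0 → 2`, `β` has arity `2 → 0`, and they satisfy
the two snake equations. -/
structure IsDuality {A : Type u} [ExtBCIAlgebra A] (α β : A) : Prop where
  arity_alpha : bullet α ⊚ B = (B ⬝ α) ⊚ compPow B 2
  arity_beta : bullet β ⊚ compPow B 3 = B ⬝ β
  duality_one : α ⊚ (B ⬝ β) = B ⬝ I
  duality_two : (B ⬝ α) ⊚ β = B ⬝ I

/-- A duality that is compatible with the twist; a balanced extensional `BC±I`-algebra with such a
pair `α`, `β` is a ribbon extensional `BC±I`-algebra. -/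
structure IsRibbonDuality {A : Type u} [BalancedExtBCIAlgebra A] (α β : A) : Prop
    extends IsDuality α β where
  duality_theta : ∀ s : Sgn,
    α ⊚ BalancedExtBCIAlgebra.θ s = α ⊚ (B ⬝ BalancedExtBCIAlgebra.θ s)

/-! ### Elementary facts needed to define the internal PRO -/

namespace ExtBCIAlgebra

variable {A : Type u} [ExtBCIAlgebra A]

theorem comp_app (a b c : A) : (a ⊚ b) ⬝ c = a ⬝ (b ⬝ c) := app_B a b c

theorem comp_I (a : A) : a ⊚ I = a := by
  have h := congrArg (fun x : A => x ⬝ a) (ax_rho (A := A) Sgn.pos)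
  simp only [app_C, ax_lambda, app_I] at h
  exact h

theorem I_comp (a : A) : I ⊚ a = a := by
  show B ⬝ I ⬝ a = a
  rw [ax_lambda, app_I]

theorem B_comp (a b : A) : B ⬝ (a ⊚ b) = (B ⬝ a) ⊚ (B ⬝ b) := by
  have h := congrArg (fun x : A => x ⬝ a ⬝ b) (ax_alpha (A := A) Sgn.pos)
  simp only [comp_app, app_C] at h
  have h2 : (B : A) ⬝ (B ⬝ (B ⬝ a)) ⬝ B ⬝ b = B ⬝ B ⬝ (B ⬝ a) ⬝ b := h
  rw [app_B, app_B] at h2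
  exact h2.symm

theorem comp_assoc (a b c : A) : (a ⊚ b) ⊚ c = a ⊚ b ⊚ c := by
  show B ⬝ (a ⊚ b) ⬝ c = _
  rw [B_comp, comp_app]; rfl

theorem C_comp (t : Sgn) (x a b : A) : (C t ⬝ x ⬝ a) ⊚ b = C t ⬝ (x ⊚ b) ⬝ a := by
  have h := congrArg (fun y : A => y ⬝ x ⬝ a ⬝ b) (ax_bc (A := A) t)
  simp only [comp_app, app_B] at h
  have h2 : B ⬝ (C t ⬝ x ⬝ a) ⬝ b = C t ⬝ (C t ⊚ (B ⬝ x)) ⬝ a ⬝ b := h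
  rw [app_C, comp_app] at h2
  exact h2

theorem bullet_comp (t : Sgn) (a b : A) : bullet a ⊚ b = C t ⬝ b ⬝ a := by
  cases t
  · rw [bullet, C_comp, I_comp]
  · rw [bullet, C_comp, I_comp, app_C_two]

theorem comp_cox (s : Sgn) : (C s : A) ⊚ C s.flip = I := by
  rw [cox_one, ax_lambda, ax_lambda]

theorem B_comp_C (s : Sgn) : (B : A) ⊚ C s = (B ⬝ C s) ⊚ C s ⊚ (B ⬝ B) := by
  have h1 : (C s : A) ⊚ C s.flip = I := comp_cox s
  have h2 : (C s.flip : A) ⊚ C s = I := by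
    have := comp_cox (A := A) s.flip
    cases s <;> exact this
  have hb := ax_bc (A := A) s.flip
  have h3 : (B ⬝ C s) ⊚ C s ⊚ ((B : A) ⬝ B) ⊚ C s.flip = B := by
    rw [hb, ← comp_assoc (C s), h1, I_comp, ← comp_assoc, ← B_comp, h1, ax_lambda, I_comp]
  calc (B : A) ⊚ C s = ((B ⬝ C s) ⊚ C s ⊚ ((B : A) ⬝ B) ⊚ C s.flip) ⊚ C s := by rw [h3]
    _ = _ := by simp only [comp_assoc, h2, comp_I]

theorem bullet_app (a b : A) : bullet (a ⬝ b) = bullet b ⊚ bullet a ⊚ B := by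
  have h := congrArg (fun x : A => x ⬝ I ⬝ a ⬝ b) (B_comp_C (A := A) Sgn.pos)
  simp only [comp_app, app_B] at h
  have e : (B : A) ⬝ B ⬝ I = B := comp_I B
  rw [e] at h
  rw [bullet_comp Sgn.pos a, bullet_comp Sgn.pos b]
  exact h

theorem bullet_I_comp_B : bullet (I : A) ⊚ B = I := by
  rw [bullet_comp Sgn.pos, ax_rho, ax_lambda]

theorem compPow_add (a : A) (m n : ℕ) : compPow a (m + n) = compPow a m ⊚ compPow a n := by
  induction m with
  | zero => simp [compPow, I_comp]
  | succ m ih => rw [Nat.succ_add]; simp only [compPow, ih, comp_assoc]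

theorem compPow_one (a : A) : compPow a 1 = a := comp_I a

theorem compPow_B_I (n : ℕ) : compPow (B : A) n ⬝ I = I := by
  induction n with
  | zero => exact app_I I
  | succ n ih => rw [compPow, comp_app, ih, ax_lambda]

theorem compPow_B_comp (n : ℕ) (a b : A) :
    compPow B n ⬝ (a ⊚ b) = (compPow B n ⬝ a) ⊚ (compPow B n ⬝ b) := by
  induction n with
  | zero => simp only [compPow, app_I]
  | succ n ih => simp only [compPow, comp_app, ih, B_comp]

/-- The interchange law: an element of arity `m → n` commutes with arbitrary elements. -/
theorem interchange {m n : ℕ} {a : A} (h : HasArity m n a) (b : A) :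
    (compPow B m ⬝ b) ⊚ a = a ⊚ (compPow B n ⬝ b) := by
  have h1 := congrArg (fun x : A => x ⬝ b) h
  simp only [comp_app, compPow] at h1
  rw [bullet, app_C, app_I] at h1
  exact h1

theorem bullet_B_comp : bullet (B : A) ⊚ B ⊚ B ⊚ B = (B ⬝ B) ⊚ B := by
  rw [← comp_assoc, bullet_comp Sgn.pos, ax_alpha]

theorem hasArity_I : HasArity 0 0 (I : A) := by
  show bullet (I : A) ⊚ compPow B 1 = (B ⬝ I) ⊚ I
  rw [compPow_one, bullet_I_comp_B, comp_I, ax_lambda]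

theorem slide (x a : A) : x ⊚ bullet a = bullet a ⊚ (B ⬝ x) := by
  have h := congrArg (fun y : A => y ⬝ x ⬝ I ⬝ a) (cox_two (A := A) Sgn.pos Sgn.pos)
  simp only [comp_app, app_C] at h
  have h1 : (B : A) ⬝ (B ⬝ (B ⬝ x)) ⬝ C Sgn.pos ⬝ I ⬝ a
      = B ⬝ C Sgn.pos ⬝ (B ⬝ (B ⬝ x)) ⬝ I ⬝ a := h
  rw [app_B, app_B, app_B] at h1
  have h2 : x ⊚ bullet a = C Sgn.pos ⬝ ((B ⬝ x) ⊚ I) ⬝ a := h1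
  rw [h2, comp_I, bullet_comp Sgn.pos]

theorem B_comp_B (x : A) : B ⊚ (B ⬝ x) = (B ⬝ (B ⬝ x)) ⊚ B := by
  have h := congrArg (fun y : A => y ⬝ x) (ax_alpha (A := A) Sgn.pos)
  simp only [comp_app, app_C] at h
  exact h.symm

theorem bullet_B_app (a : A) (k : ℕ) :
    bullet (B ⬝ a) ⊚ compPow B (k + 2) = B ⊚ bullet a ⊚ compPow B (k + 1) := by
  rw [bullet_app, ← comp_assoc B, slide B a]
  have h : bullet (B : A) ⊚ B ⊚ B ⊚ B ⊚ compPow B k = (B ⬝ B) ⊚ B ⊚ compPow B k := by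
    have := congrArg (fun y : A => y ⊚ compPow B k) (bullet_B_comp (A := A))
    simpa only [comp_assoc] using this
  simp only [compPow, comp_assoc, h]

theorem hasArity_comp {l m n : ℕ} {a b : A} (ha : HasArity l m a) (hb : HasArity m n b) :
    HasArity l n (a ⊚ b) := by
  unfold HasArity at ha hb ⊢
  have e : bullet (a ⊚ b) = bullet b ⊚ bullet (B ⬝ a) ⊚ B := bullet_app (B ⬝ a) b
  calc bullet (a ⊚ b) ⊚ compPow B (l + 1)
      = bullet b ⊚ bullet (B ⬝ a) ⊚ compPow B (l + 2) := by
        rw [e]; simp only [compPow, comp_assoc]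
    _ = bullet b ⊚ B ⊚ (B ⬝ a) ⊚ compPow B m := by rw [bullet_B_app, ha]
    _ = (bullet b ⊚ (B ⬝ (B ⬝ a))) ⊚ compPow B (m + 1) := by
        rw [← comp_assoc B, B_comp_B]; simp only [compPow, comp_assoc]
    _ = (B ⬝ a) ⊚ bullet b ⊚ compPow B (m + 1) := by rw [← slide, comp_assoc]
    _ = (B ⬝ (a ⊚ b)) ⊚ compPow B n := by rw [hb, B_comp, comp_assoc]

theorem hasArity_B {m n : ℕ} {a : A} (ha : HasArity m n a) :
    HasArity (m + 1) (n + 1) (B ⬝ a) := by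
  unfold HasArity at ha ⊢
  rw [bullet_B_app, ha, ← comp_assoc, B_comp_B]
  simp only [compPow, comp_assoc]

theorem hasArity_add {m n : ℕ} {a : A} (ha : HasArity m n a) (l : ℕ) :
    HasArity (m + l) (n + l) a := by
  unfold HasArity at ha ⊢
  rw [Nat.add_right_comm, compPow_add B (m + 1) l, compPow_add B n l, ← comp_assoc, ha, comp_assoc]

theorem hasArity_pow {m n : ℕ} {a : A} (ha : HasArity m n a) (l : ℕ) :
    HasArity (l + m) (l + n) (compPow B l ⬝ a) := by
  induction l with
  | zero => simpa only [compPow, app_I, Nat.zero_add] using ha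
  | succ l ih =>
    have := hasArity_B ih
    rwa [Nat.add_right_comm l m, Nat.add_right_comm l n, ← comp_app] at this

theorem hasArity_id {m n : ℕ} (h : m = n) : HasArity m n (I : A) := by
  subst h
  simpa using hasArity_add (hasArity_I (A := A)) m

end ExtBCIAlgebra

open ExtBCIAlgebra

/-! ### The internal PRO -/

/-- The objects of the internal PRO of `A`: natural numbers (of wires). -/
structure InternalPRO (A : Type u) where
  /-- the number of wires -/
  wires : ℕ

namespace InternalPRO

variable {A : Type u} [ExtBCIAlgebra A]

/-- A morphism `m → n` of the internal PRO is an element of `A` of arity `m → n`. -/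
@[ext]
structure Hom (X Y : InternalPRO A) where
  /-- the underlying element -/
  val : A
  arity : HasArity X.wires Y.wires val

/-- The category with `id = I` and `f ≫ g = f ∘ g`. -/
instance : Category.{u} (InternalPRO A) where
  Hom := Hom
  id _ := ⟨I, hasArity_id rfl⟩
  comp f g := ⟨f.val ⊚ g.val, hasArity_comp f.arity g.arity⟩
  id_comp f := Hom.ext (I_comp f.val)
  comp_id f := Hom.ext (comp_I f.val)
  assoc f g h := Hom.ext (comp_assoc f.val g.val h.val)

theorem hom_ext {X Y : InternalPRO A} {f g : X ⟶ Y} (h : f.val = g.val) : f = g := Hom.ext h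

/-- The identity between equal numbers of wires. -/
def idIso {X Y : InternalPRO A} (h : X.wires = Y.wires) : X ≅ Y where
  hom := ⟨I, hasArity_id h⟩
  inv := ⟨I, hasArity_id h.symm⟩
  hom_inv_id := hom_ext (I_comp I)
  inv_hom_id := hom_ext (I_comp I)

/-- The tensor product is addition on objects; on morphisms `l + f = Bˡ f`, `f + l = f`, and
`f + g = (f + m') ≫ (n + g)` for `f : m → n`, `g : m' → n'`. The coherence isomorphisms are
identities. -/
instance : MonoidalCategoryStruct (InternalPRO A) where
  tensorObj X Y := ⟨X.wires + Y.wires⟩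
  whiskerLeft X _ _ f := ⟨compPow B X.wires ⬝ f.val, hasArity_pow f.arity X.wires⟩
  whiskerRight f Y := ⟨f.val, hasArity_add f.arity Y.wires⟩
  tensorHom {_ Y₁ X₂ _} f g := ⟨f.val ⊚ (compPow B Y₁.wires ⬝ g.val),
    hasArity_comp (hasArity_add f.arity X₂.wires) (hasArity_pow g.arity Y₁.wires)⟩
  tensorUnit := ⟨0⟩
  associator _ _ _ := idIso (Nat.add_assoc _ _ _)
  leftUnitor _ := idIso (Nat.zero_add _)
  rightUnitor _ := idIso (Nat.add_zero _)

instance : MonoidalCategory (InternalPRO A) where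
  tensorHom_def _ _ := rfl
  id_tensorHom_id X₁ _ := hom_ext (by
    show (I : A) ⊚ (compPow B X₁.wires ⬝ I) = I
    rw [compPow_B_I, I_comp])
  tensorHom_comp_tensorHom {_ Y₁ Z₁ _ _ _} f₁ f₂ g₁ g₂ := hom_ext (by
    show (f₁.val ⊚ (compPow B Y₁.wires ⬝ f₂.val)) ⊚ g₁.val ⊚ (compPow B Z₁.wires ⬝ g₂.val)
      = (f₁.val ⊚ g₁.val) ⊚ (compPow B Z₁.wires ⬝ (f₂.val ⊚ g₂.val))
    have h := interchange g₁.arity f₂.val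
    rw [compPow_B_comp, comp_assoc, comp_assoc, ← comp_assoc _ g₁.val, h, comp_assoc])
  whiskerLeft_id X _ := hom_ext (compPow_B_I X.wires)
  id_whiskerRight _ _ := rfl
  associator_naturality {_ _ _ Y₁ Y₂ _} f₁ f₂ f₃ := hom_ext (by
    show ((f₁.val ⊚ (compPow B Y₁.wires ⬝ f₂.val)) ⊚ (compPow B (Y₁.wires + Y₂.wires) ⬝ f₃.val)) ⊚ I
      = I ⊚ f₁.val ⊚ (compPow B Y₁.wires ⬝ (f₂.val ⊚ (compPow B Y₂.wires ⬝ f₃.val)))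
    rw [compPow_B_comp, comp_I, I_comp, comp_assoc, compPow_add, comp_app])
  leftUnitor_naturality f := hom_ext (by
    show ((I : A) ⬝ f.val) ⊚ I = I ⊚ f.val
    rw [app_I, comp_I, I_comp])
  rightUnitor_naturality f := hom_ext (by
    show f.val ⊚ I = I ⊚ f.val
    rw [comp_I, I_comp])
  pentagon W _ _ _ := hom_ext (by
    show (I : A) ⊚ I ⊚ (compPow B W.wires ⬝ I) = I ⊚ I
    rw [compPow_B_I, I_comp])
  triangle X _ := hom_ext (by
    show (I : A) ⊚ (compPow B X.wires ⬝ I) = I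
    rw [compPow_B_I, I_comp])

end InternalPRO

/-- The element `σ_{m,1} : m + 1 → 1 + m` generated by `C⁺`. -/
def sigmaOne (A : Type u) [ExtBCIAlgebra A] : ℕ → A
  | 0 => I
  | m + 1 => (B ⬝ sigmaOne A m) ⊚ C Sgn.pos

/-- The element `σ_{m,n} : m + n → n + m` generated by `C⁺`. -/
def sigma (A : Type u) [ExtBCIAlgebra A] (m : ℕ) : ℕ → A
  | 0 => I
  | n + 1 => sigmaOne A m ⊚ (B ⬝ sigma A m n)

/-- The element `θ_m : m → m` generated by `θ⁺`. -/
def theta (A : Type u) [BalancedExtBCIAlgebra A] : ℕ → A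
  | 0 => I
  | m + 1 => BalancedExtBCIAlgebra.θ Sgn.pos ⊚ sigma A 1 m ⊚ theta A m ⊚ sigma A m 1

/-- The element `α_n : 0 → n + n` made of `n` nested copies of `α`. -/
def nestedUnit {A : Type u} [ExtBCIAlgebra A] (α : A) : ℕ → A
  | 0 => I
  | n + 1 => α ⊚ (B ⬝ nestedUnit α n)

/-- The element `β_n : n + n → 0` made of `n` nested copies of `β`. -/
def nestedCounit {A : Type u} [ExtBCIAlgebra A] (β : A) : ℕ → A
  | 0 => I
  | n + 1 => (compPow B n ⬝ β) ⊚ nestedCounit β n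

/-! ### Balanced monoidal categories and ribbon categories -/

/-- A balanced monoidal category: a braided monoidal category with a twist. -/
class BalancedMonoidalCategory (𝒞 : Type u) [Category.{v} 𝒞] [MonoidalCategory 𝒞]
    extends BraidedCategory 𝒞 where
  /-- the twist -/
  twist : ∀ X : 𝒞, X ≅ X
  twist_naturality : ∀ {X Y : 𝒞} (f : X ⟶ Y), f ≫ (twist Y).hom = (twist X).hom ≫ f
  twist_tensor : ∀ X Y : 𝒞, (twist (X ⊗ Y)).hom =
    (braiding X Y).hom ≫ ((twist Y).hom ⊗ₘ (twist X).hom) ≫ (braiding Y X).hom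

/-- A ribbon (tortile) category: a balanced monoidal category in which every object `X` has a
chosen dual `X*`, with unit `𝟙_ ⟶ X ⊗ X*` and counit `X* ⊗ X ⟶ 𝟙_`, such that the dual of the
twist of `X` is the twist of `X*`. (A dual on this side is called a left dual by some authors and
a right dual, written `Xᘁ`, in Mathlib.) -/
class RibbonCategory (𝒞 : Type u) [Category.{v} 𝒞] [MonoidalCategory 𝒞]
    extends BalancedMonoidalCategory 𝒞, RightRigidCategory 𝒞 where
  twist_dual : ∀ X : 𝒞, rightAdjointMate (twist X).hom = (twist (HasRightDual.rightDual X)).hom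

/-! The difficulty is naturality: the braid and the twist must commute with every element of arity
`m → n`, and such an element need not be built from the constants, so no induction on terms is
available. The arity equation `a• ∘ Bᵐ⁺¹ = (B a) ∘ Bⁿ` replaces it. It ties `a` to the point `a• : 0
→ 1` and to `Bⁿ : n + 1 → 1`, and for these two kinds of element naturality is read off the axioms
(`bullet_comp_C`, `compPow_B_comp_C`; `bullet_comp_θ`, `compPow_B_comp_theta`). Moving `C` or `θ`
through both sides gives the naturality square of `a`, followed by a tail containing powers of `B`.
The tail is cancellable: precomposing with the point `tuple•` turns it into a map packing `n` wires
into one, and a packed tuple can be unpacked again (`B_tuple_comp`). This yields `sigOne_naturality`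
and `theta_naturality`.

The rest is braid calculus. Working with both signs at once makes the inverse of a braid another
instance of the same family, so naturality in the second variable comes by inversion. The twist
formula rests on a cocycle identity for double braids (`B_dbraid_comp`). The snake equations for
nested cups reduce to those of `α` and `β`. The twist passes from one leg of a nested cup to the
other because a crossing does so with its sign reversed, and a double braid crosses two cups
(`nestedUnit_dbraid`). -/

namespace Sgn

theorem flip_flip (s : Sgn) : s.flip.flip = s := by
  cases s <;> rfl

end Sgn

namespace ExtBCIAlgebra

variable {A : Type u} [ExtBCIAlgebra A]

instance : Std.Associative (comp (A := A)) := ⟨comp_assoc⟩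

/-! ### Cancellation of composites with powers of `B` -/

theorem C_comp_C_flip_assoc (s : Sgn) (a : A) : C s ⊚ C s.flip ⊚ a = a := by
  rw [← comp_assoc, comp_cox, I_comp]

theorem C_flip_comp_C (s : Sgn) : (C s.flip : A) ⊚ C s = I := by
  simpa only [Sgn.flip_flip] using comp_cox (A := A) s.flip

/-- Naturality of the crossing at the point `a• : 0 → 1`, where `σ_{0,1} = I`. Both signs are
allowed, since a point has no incoming wire to be tangled with. -/
theorem bullet_comp_C (t : Sgn) (a : A) : bullet a ⊚ C t = B ⬝ bullet a := by
  have h := congrArg (fun y : A => y ⬝ I ⬝ a) (ax_bc (A := A) t)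
  simp only [comp_app, ax_lambda] at h
  have e : (B : A) ⬝ B ⬝ (C t ⬝ I) ⬝ a = B ⬝ (C t ⬝ I ⬝ a) := app_B _ _ _
  have e2 : (B : A) ⬝ C t ⬝ I = C t := comp_I _
  rw [e, e2] at h
  rw [bullet_comp t, ← h, ← bullet_comp t, comp_I]

theorem hasArity_C (s : Sgn) : HasArity 2 2 (C s : A) := by
  have h := cox_two (A := A) Sgn.pos s
  rw [← bullet_comp] at h
  simp only [HasArity, compPow, comp_I, ← comp_assoc] at h ⊢
  exact h

theorem hasArity_two_one_B : HasArity 2 1 (B : A) := by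
  have h := bullet_B_comp (A := A)
  simpa only [HasArity, compPow, comp_I] using h

/-- Expanding `(C⁺ I a)•` produces the factor `(C⁺)•`, which the arity of `C⁺` absorbs. Every
element thus becomes a morphism `0 → 1`, to which naturality of double braids applies. -/
theorem hasArity_bullet (a : A) : HasArity 0 1 (bullet a) := by
  have hI : bullet (I : A) ⊚ B ⊚ B = B := by
    rw [← comp_assoc, bullet_I_comp_B, I_comp]
  have hC : bullet (C Sgn.pos : A) ⊚ B ⊚ B ⊚ B = (B ⬝ C Sgn.pos) ⊚ B ⊚ B := by
    simpa only [HasArity, compPow, comp_I] using hasArity_C (A := A) Sgn.pos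
  have h : bullet (bullet a) ⊚ B = (B ⬝ bullet a) ⊚ B := by
    calc bullet (C Sgn.pos ⬝ I ⬝ a) ⊚ B
        = bullet a ⊚ bullet I ⊚ bullet (C Sgn.pos) ⊚ B ⊚ B ⊚ B := by
          rw [bullet_app (C Sgn.pos ⬝ I) a, bullet_app]; simp only [comp_assoc]
      _ = bullet a ⊚ C Sgn.pos ⊚ B := by
          rw [hC, ← comp_assoc (bullet I), ← slide, comp_assoc, hI]
      _ = (B ⬝ bullet a) ⊚ B := by rw [← comp_assoc, bullet_comp_C]
  simpa only [HasArity, compPow, comp_I] using h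

theorem comp_compPow_B_app_I (a : A) (n : ℕ) : (a ⊚ compPow B n) ⬝ I = a ⬝ I := by
  rw [comp_app, compPow_B_I]

/-- Evaluation at `I` recovers `a`: powers of `B` fix `I`, and `B a I = a ∘ I = a`. -/
theorem eq_of_B_comp_compPow {a b : A} {n : ℕ}
    (h : (B ⬝ a) ⊚ compPow B n = (B ⬝ b) ⊚ compPow B n) : a = b := by
  have h := congrArg (· ⬝ I) h
  simp only [comp_compPow_B_app_I] at h
  change a ⊚ I = b ⊚ I at h
  simpa only [comp_I] using h

theorem bullet_app_I_comp {m n : ℕ} {a : A} (h : HasArity (m + 1) (n + 1) a) :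
    bullet (a ⬝ I) ⊚ compPow B (m + 1) = a ⊚ compPow B n := by
  have e : bullet (I : A) ⊚ B ⊚ compPow B n = compPow B n := by
    rw [← comp_assoc, bullet_I_comp_B, I_comp]
  calc bullet (a ⬝ I) ⊚ compPow B (m + 1)
      = bullet I ⊚ bullet a ⊚ compPow B (m + 1 + 1) := by
        rw [bullet_app]; simp only [compPow, comp_assoc]
    _ = bullet I ⊚ (B ⬝ a) ⊚ compPow B (n + 1) := by rw [h]
    _ = a ⊚ compPow B n := by
        rw [← comp_assoc, ← slide, comp_assoc, compPow, e]

/-! ### The braid -/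

/-- The element `σ_{m,1} : m + 1 → 1 + m` generated by `C s`. -/
def sigOne (A : Type u) [ExtBCIAlgebra A] (s : Sgn) : ℕ → A
  | 0 => I
  | m + 1 => (B ⬝ sigOne A s m) ⊚ C s

/-- The element `σ_{m,n} : m + n → n + m` generated by `C s`. -/
def sig (A : Type u) [ExtBCIAlgebra A] (s : Sgn) (m : ℕ) : ℕ → A
  | 0 => I
  | n + 1 => sigOne A s m ⊚ (B ⬝ sig A s m n)

theorem sigmaOne_eq (m : ℕ) : sigmaOne A m = sigOne A Sgn.pos m := by
  induction m with
  | zero => rfl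
  | succ m ih => rw [sigmaOne, sigOne, ih]

theorem sigma_eq (m n : ℕ) : sigma A m n = sig A Sgn.pos m n := by
  induction n with
  | zero => rfl
  | succ n ih => rw [sigma, sig, ih, sigmaOne_eq]

theorem sigOne_one (s : Sgn) : sigOne A s 1 = C s := by
  rw [sigOne, sigOne, ax_lambda, I_comp]

theorem sig_one (s : Sgn) (m : ℕ) : sig A s m 1 = sigOne A s m := by
  rw [sig, sig, ax_lambda, comp_I]

theorem hasArity_sigOne (s : Sgn) (m : ℕ) : HasArity (m + 1) (m + 1) (sigOne A s m) := by
  induction m with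
  | zero => exact hasArity_id rfl
  | succ m ih =>
    have h := hasArity_add (hasArity_C (A := A) s) m
    rw [Nat.add_comm] at h
    exact hasArity_comp (hasArity_B ih) h

theorem hasArity_sig (s : Sgn) (m n : ℕ) : HasArity (m + n) (n + m) (sig A s m n) := by
  induction n with
  | zero => exact hasArity_id (Nat.add_comm _ _)
  | succ n ih =>
    have h1 := hasArity_add (hasArity_sigOne (A := A) s m) n
    have h2 := hasArity_B ih
    rw [show m + 1 + n = m + n + 1 by omega] at h1
    rw [show n + m + 1 = n + 1 + m by omega] at h2
    exact hasArity_comp h1 h2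

theorem C_interchange (s : Sgn) (a : A) :
    (B ⬝ (B ⬝ a)) ⊚ C s = C s ⊚ (B ⬝ (B ⬝ a)) := by
  simpa only [compPow, comp_app, app_I] using interchange (hasArity_C s) a

/-- Naturality of the braid at `Bⁿ : n + 1 → 1`, by iterating the case `n = 1`, which is `B_comp_C`.
-/
theorem compPow_B_comp_C (s : Sgn) (n : ℕ) :
    compPow B n ⊚ C s = sigOne A s (n + 1) ⊚ (B ⬝ compPow B n) := by
  induction n with
  | zero => rw [compPow, I_comp, ax_lambda, comp_I, sigOne_one]
  | succ n ih =>
    have e : (B : A) ⊚ (B ⬝ sigOne A s n) = (B ⬝ (B ⬝ sigOne A s n)) ⊚ B := B_comp_B _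
    have h1 := B_comp_C (A := A) s
    rw [compPow, comp_assoc, ih, B_comp, sigOne, sigOne, sigOne, B_comp]
    grind only [= comp_assoc]

theorem sigOne_comp_sig (s : Sgn) (n : ℕ) : sigOne A s n ⊚ sig A s.flip 1 n = I := by
  induction n with
  | zero => exact I_comp I
  | succ n ih =>
    rw [sigOne, sig, sigOne_one, comp_assoc, C_comp_C_flip_assoc, ← B_comp, ih, ax_lambda]

theorem sig_comp_sigOne (s : Sgn) (n : ℕ) : sig A s.flip 1 n ⊚ sigOne A s n = I := by
  induction n with
  | zero => exact I_comp I
  | succ n ih =>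
    rw [sigOne, sig, sigOne_one, comp_assoc, ← comp_assoc (B ⬝ _), ← B_comp, ih, ax_lambda,
      I_comp, C_flip_comp_C]

/-- The element `f` with `f x₁ ⋯ xₙ g = g x₁ ⋯ xₙ`. -/
def tuple (A : Type u) [ExtBCIAlgebra A] (n : ℕ) : A := sigOne A Sgn.neg n ⬝ I

theorem bullet_tuple_comp (n : ℕ) :
    bullet (tuple A n) ⊚ compPow B (n + 1) = sigOne A Sgn.neg n ⊚ compPow B n :=
  bullet_app_I_comp (hasArity_sigOne _ _)

/-- The mirror image of `compPow_B_comp_C`, obtained from its negative version by inverting the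
crossings on both sides. -/
theorem B_compPow_comp_C (n : ℕ) :
    (B ⬝ compPow B n) ⊚ (C Sgn.pos : A) = sig A Sgn.pos 1 (n + 1) ⊚ compPow B n := by
  have h := compPow_B_comp_C (A := A) Sgn.neg n
  have h1 : sig A Sgn.pos 1 (n + 1) ⊚ sigOne A Sgn.neg (n + 1) = I := sig_comp_sigOne Sgn.neg _
  have h2 : (C Sgn.neg : A) ⊚ C Sgn.pos = I := comp_cox Sgn.neg
  calc (B ⬝ compPow B n) ⊚ (C Sgn.pos : A)
      = (sig A Sgn.pos 1 (n + 1) ⊚ sigOne A Sgn.neg (n + 1)) ⊚ (B ⬝ compPow B n) ⊚ C Sgn.pos := by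
        rw [h1, I_comp]
    _ = sig A Sgn.pos 1 (n + 1) ⊚ (sigOne A Sgn.neg (n + 1) ⊚ (B ⬝ compPow B n)) ⊚ C Sgn.pos := by
        simp only [comp_assoc]
    _ = _ := by rw [← h, comp_assoc, h2, comp_I]

/-- Encoding `n` wires in one by `tuple` and applying the result to a function amounts to
applying the function to the `n` wires. -/
theorem B_tuple_comp (n : ℕ) :
    (B ⬝ (bullet (tuple A n) ⊚ compPow B n)) ⊚ C Sgn.pos ⊚ B = compPow B n := by
  have h1 : sig A Sgn.pos 1 n ⊚ sigOne A Sgn.neg n = I := sig_comp_sigOne Sgn.neg _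
  have h2 : (C Sgn.neg : A) ⊚ C Sgn.pos = I := comp_cox Sgn.neg
  -- The sign at a point is free; the negative one is chosen to cancel the `C⁺` of the statement.
  have h3 := bullet_comp_C Sgn.neg (tuple A n)
  have h4 := compPow_add (B : A) n 1
  rw [compPow_one] at h4
  calc (B ⬝ (bullet (tuple A n) ⊚ compPow B n)) ⊚ C Sgn.pos ⊚ B
      = (B ⬝ bullet (tuple A n)) ⊚ ((B ⬝ compPow B n) ⊚ C Sgn.pos) ⊚ B := by
        rw [B_comp]; simp only [comp_assoc]
    _ = bullet (tuple A n) ⊚ (C Sgn.neg ⊚ C Sgn.pos) ⊚ (B ⬝ sig A Sgn.pos 1 n)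
          ⊚ compPow B n ⊚ B := by
        rw [B_compPow_comp_C, ← h3, sig, sigOne_one]; simp only [comp_assoc]
    _ = (bullet (tuple A n) ⊚ (B ⬝ sig A Sgn.pos 1 n)) ⊚ compPow B (n + 1) := by
        rw [h2, I_comp, ← h4, comp_assoc]
    _ = compPow B n := by
        rw [← slide, comp_assoc, bullet_tuple_comp, ← comp_assoc, h1, I_comp]

theorem cancel_tuple {a b : A} {n : ℕ}
    (h : a ⊚ bullet (tuple A n) ⊚ compPow B n = b ⊚ bullet (tuple A n) ⊚ compPow B n) :
    a = b := by
  refine eq_of_B_comp_compPow (n := n) ?_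
  rw [← B_tuple_comp n, ← comp_assoc, ← comp_assoc (B ⬝ b), ← B_comp, ← B_comp, h]

/-- One more `B` on the right carries the packing map out of the outer `B`, after which
`B_tuple_comp` unpacks it; the price is the exponent `n + 1`. -/
theorem cancel_B_tuple {a b : A} {n : ℕ}
    (h : a ⊚ (B ⬝ (bullet (tuple A n) ⊚ compPow B n))
      = b ⊚ (B ⬝ (bullet (tuple A n) ⊚ compPow B n))) :
    a = b := by
  have e := B_tuple_comp (A := A) n
  have e2 : (B : A) ⊚ (B ⬝ (bullet (tuple A n) ⊚ compPow B n))
      = (B ⬝ (B ⬝ (bullet (tuple A n) ⊚ compPow B n))) ⊚ B := B_comp_B _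
  have key (x : A) : (B ⬝ (x ⊚ (B ⬝ (bullet (tuple A n) ⊚ compPow B n)))) ⊚ B ⊚ C Sgn.pos ⊚ B
      = (B ⬝ x) ⊚ compPow B (n + 1) := by
    rw [B_comp, comp_assoc, ← comp_assoc (B ⬝ (B ⬝ _)), ← e2, comp_assoc, e, compPow]
  refine eq_of_B_comp_compPow (n := n + 1) ?_
  rw [← key a, ← key b, h]

/-! ### Naturality of the braid -/

/-- The composite `(B a) ∘ Bⁿ ∘ C` is computed twice: directly, and after replacing `(B a) ∘ Bⁿ` by
`a• ∘ Bᵐ⁺¹`. The results are the two sides of the square under `B`, with the common tail `C ∘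
B(Bⁿ)`. -/
theorem sigOne_naturality {m n : ℕ} {a : A} (h : HasArity m n a) (s : Sgn) :
    a ⊚ sigOne A s n = sigOne A s m ⊚ (B ⬝ a) := by
  have h1 : bullet a ⊚ compPow B (m + 1) ⊚ C s
      = sigOne A s (m + 1) ⊚ (B ⬝ (bullet a ⊚ compPow B (m + 1))) := by
    rw [compPow_B_comp_C, sigOne, comp_assoc, ← comp_assoc, ← slide, comp_assoc,
      ← comp_assoc (bullet a), bullet_comp_C, B_comp]
  have h2 : (B ⬝ (a ⊚ sigOne A s n)) ⊚ C s ⊚ (B ⬝ compPow B n)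
      = (B ⬝ (sigOne A s m ⊚ (B ⬝ a))) ⊚ C s ⊚ (B ⬝ compPow B n) := by
    calc (B ⬝ (a ⊚ sigOne A s n)) ⊚ C s ⊚ (B ⬝ compPow B n)
        = (B ⬝ a) ⊚ compPow B n ⊚ C s := by
          rw [compPow_B_comp_C, sigOne, B_comp]; simp only [comp_assoc]
      _ = (bullet a ⊚ compPow B (m + 1)) ⊚ C s := by rw [h, comp_assoc]
      _ = (B ⬝ sigOne A s m) ⊚ (C s ⊚ (B ⬝ (B ⬝ a))) ⊚ (B ⬝ compPow B n) := by
          rw [comp_assoc, h1, h, sigOne, B_comp]; simp only [comp_assoc]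
      _ = _ := by rw [← C_interchange, B_comp]; simp only [comp_assoc]
  -- The point `tuple•` strips the `B` from `x` and absorbs the crossing, leaving a cancellable
  -- tail.
  have key (x : A) : bullet (tuple A n) ⊚ (B ⬝ x) ⊚ C s ⊚ (B ⬝ compPow B n)
      = x ⊚ (B ⬝ (bullet (tuple A n) ⊚ compPow B n)) := by
    rw [← comp_assoc, ← slide, comp_assoc, ← comp_assoc (bullet _), bullet_comp_C, B_comp]
  refine cancel_B_tuple (n := n) ?_
  rw [← key, ← key, h2]

theorem sig_naturality {m n : ℕ} {a : A} (h : HasArity m n a) (s : Sgn) (k : ℕ) :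
    a ⊚ sig A s n k = sig A s m k ⊚ (compPow B k ⬝ a) := by
  induction k with
  | zero => simp only [sig, compPow, comp_I, I_comp, app_I]
  | succ k ih =>
    rw [sig, sig, ← comp_assoc, sigOne_naturality h, comp_assoc, ← B_comp, ih, B_comp, comp_assoc,
      compPow, comp_app]

/-! ### Hexagon identities, invertibility and right naturality of the braid -/

theorem sigOne_interchange (s : Sgn) (m : ℕ) (a : A) :
    (B ⬝ (compPow B m ⬝ a)) ⊚ sigOne A s m = sigOne A s m ⊚ (B ⬝ (compPow B m ⬝ a)) := by
  simpa only [compPow, comp_app] using interchange (hasArity_sigOne s m) a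

theorem compPow_B_comm (m n : ℕ) (a : A) :
    compPow B m ⬝ (compPow B n ⬝ a) = compPow B n ⬝ (compPow B m ⬝ a) := by
  rw [← comp_app, ← comp_app, ← compPow_add, ← compPow_add, Nat.add_comm]

theorem compPow_B_app (m : ℕ) (a : A) : compPow B m ⬝ (B ⬝ a) = B ⬝ (compPow B m ⬝ a) := by
  simpa only [compPow_one] using compPow_B_comm m 1 a

theorem sigOne_add (s : Sgn) (m n : ℕ) :
    sigOne A s (m + n) = (compPow B m ⬝ sigOne A s n) ⊚ sigOne A s m := by
  induction m with
  | zero => simp only [Nat.zero_add, sigOne, compPow, comp_I, app_I]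
  | succ m ih => rw [Nat.add_right_comm, sigOne, ih, sigOne, compPow, comp_app, B_comp, comp_assoc]

theorem sig_add_right (s : Sgn) (m n k : ℕ) :
    sig A s m (n + k) = sig A s m n ⊚ (compPow B n ⬝ sig A s m k) := by
  induction n with
  | zero => simp only [Nat.zero_add, sig, compPow, I_comp, app_I]
  | succ n ih => rw [Nat.add_right_comm, sig, ih, sig, compPow, comp_app, B_comp, comp_assoc]

theorem sig_add_left (s : Sgn) (m n k : ℕ) :
    sig A s (m + n) k = (compPow B m ⬝ sig A s n k) ⊚ sig A s m k := by
  induction k with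
  | zero => simp only [sig, compPow_B_I, comp_I]
  | succ k ih =>
    rw [sig, ih, sig, sig, sigOne_add, B_comp, compPow_B_comp, comp_assoc, comp_assoc,
      ← comp_assoc (sigOne A s m), ← sigOne_interchange, comp_assoc, compPow_B_app]

theorem sig_zero_left (s : Sgn) (n : ℕ) : sig A s 0 n = I := by
  induction n with
  | zero => rfl
  | succ n ih => rw [sig, ih, sigOne, ax_lambda, I_comp]

theorem sig_comp_sig (s : Sgn) (m n : ℕ) : sig A s m n ⊚ sig A s.flip n m = I := by
  induction n with
  | zero => rw [sig_zero_left, sig, I_comp]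
  | succ n ih =>
    rw [sig, Nat.add_comm n 1, sig_add_left, compPow_one, comp_assoc, ← comp_assoc (B ⬝ _),
      ← B_comp, ih, ax_lambda, I_comp, sigOne_comp_sig]

theorem sig_comp_sig_flip (s : Sgn) (m n : ℕ) : sig A s.flip m n ⊚ sig A s n m = I := by
  simpa only [Sgn.flip_flip] using sig_comp_sig s.flip m n

/-- Left naturality for the opposite sign, conjugated by the braids that invert it. -/
theorem sig_naturality_right {m n : ℕ} {a : A} (h : HasArity m n a) (s : Sgn) (k : ℕ) :
    (compPow B k ⬝ a) ⊚ sig A s k n = sig A s k m ⊚ a := by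
  have e := sig_naturality h s.flip k
  calc (compPow B k ⬝ a) ⊚ sig A s k n
      = (sig A s k m ⊚ sig A s.flip m k) ⊚ (compPow B k ⬝ a) ⊚ sig A s k n := by
        rw [sig_comp_sig, I_comp]
    _ = sig A s k m ⊚ (sig A s.flip m k ⊚ (compPow B k ⬝ a)) ⊚ sig A s k n := by
        simp only [comp_assoc]
    _ = sig A s k m ⊚ a := by rw [← e, comp_assoc, sig_comp_sig_flip, comp_I]

/-! ### The double braid -/

/-- The double braid `σ_{m,n} ∘ σ_{n,m}` on `m + n` wires. -/
def dbraid (A : Type u) [ExtBCIAlgebra A] (m n : ℕ) : A := sig A Sgn.pos m n ⊚ sig A Sgn.pos n m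

theorem hasArity_dbraid (m n : ℕ) : HasArity (m + n) (m + n) (dbraid A m n) :=
  hasArity_comp (hasArity_sig _ m n) (hasArity_sig _ n m)

theorem dbraid_zero_left (n : ℕ) : dbraid A 0 n = I := by
  rw [dbraid, sig_zero_left, sig, I_comp]

theorem dbraid_naturality {m n : ℕ} {a : A} (h : HasArity m n a) (k : ℕ) :
    a ⊚ dbraid A n k = dbraid A m k ⊚ a := by
  rw [dbraid, ← comp_assoc, sig_naturality h, comp_assoc, sig_naturality_right h, dbraid,
    comp_assoc]

theorem dbraid_naturality_right {m n : ℕ} {a : A} (h : HasArity m n a) (k : ℕ) :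
    (compPow B k ⬝ a) ⊚ dbraid A k n = dbraid A k m ⊚ (compPow B k ⬝ a) := by
  rw [dbraid, ← comp_assoc, sig_naturality_right h, comp_assoc, sig_naturality h, dbraid,
    comp_assoc]

/-- A cocycle identity that makes the twist of a sum independent of bracketing. It follows from the
hexagons and naturality of the braid with respect to braids. -/
theorem B_dbraid_comp (k m n : ℕ) :
    (compPow B k ⬝ dbraid A m n) ⊚ dbraid A k (m + n)
      = dbraid A k m ⊚ dbraid A (k + m) n := by
  have e1 := sig_naturality (hasArity_sig (A := A) Sgn.pos m k) Sgn.pos n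
  have e2 := sig_naturality (hasArity_sig (A := A) Sgn.pos m n) Sgn.pos k
  calc (compPow B k ⬝ dbraid A m n) ⊚ dbraid A k (m + n)
      = sig A Sgn.pos k (m + n) ⊚ (sig A Sgn.pos (m + n) k
          ⊚ (compPow B k ⬝ sig A Sgn.pos m n)) ⊚ (compPow B k ⬝ sig A Sgn.pos n m) := by
        rw [dbraid_naturality_right (hasArity_dbraid m n), dbraid, dbraid, compPow_B_comp]
        simp only [comp_assoc]
    _ = sig A Sgn.pos k m ⊚ (sig A Sgn.pos (m + k) n ⊚ (compPow B n ⬝ sig A Sgn.pos m k))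
          ⊚ sig A Sgn.pos n (k + m) := by
        rw [← e2, sig_add_right, sig_add_left, sig_add_left, sig_add_right _ n]
        simp only [comp_assoc]
    _ = _ := by rw [← e1, dbraid, dbraid]; simp only [comp_assoc]

end ExtBCIAlgebra

namespace BalancedExtBCIAlgebra

variable {A : Type u} [BalancedExtBCIAlgebra A]

/-! ### The twist -/

theorem hasArity_θ (s : Sgn) : HasArity 1 1 (θ s : A) := by
  have h := theta_one (A := A) Sgn.pos s
  rw [← bullet_comp] at h
  simp only [HasArity, compPow, comp_I, ← comp_assoc] at h ⊢
  rw [h, comp_assoc]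

/-- Naturality of the twist at the point `a• : 0 → 1`, where `θ_0 = I`. -/
theorem bullet_comp_θ (s : Sgn) (a : A) : bullet a ⊚ θ s = bullet a := by
  rw [bullet_comp Sgn.pos, theta_three]; rfl

theorem theta_one_eq : theta A 1 = θ Sgn.pos := by
  simp only [theta, sigma, sigmaOne, ax_lambda, comp_I]

theorem hasArity_theta (n : ℕ) : HasArity n n (theta A n) := by
  induction n with
  | zero => exact hasArity_I
  | succ n ih =>
    have h1 := hasArity_add (hasArity_θ (A := A) Sgn.pos) n
    have h2 := hasArity_sig (A := A) Sgn.pos 1 n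
    rw [Nat.add_comm] at h1 h2
    rw [theta, sigma_eq, sigma_eq]
    exact hasArity_comp h1 (hasArity_comp h2 (hasArity_comp (hasArity_add ih 1)
      (hasArity_sig Sgn.pos n 1 |> (Nat.add_comm 1 n ▸ ·))))

theorem theta_succ (n : ℕ) :
    theta A (n + 1) = θ Sgn.pos ⊚ (B ⬝ theta A n) ⊚ dbraid A 1 n := by
  have h := sig_naturality_right (hasArity_theta (A := A) n) Sgn.pos 1
  rw [compPow_one] at h
  rw [theta, sigma_eq, sigma_eq, ← comp_assoc (sig _ _ _ _), ← h, dbraid, comp_assoc]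

theorem θ_interchange (s : Sgn) (a : A) : (B ⬝ a) ⊚ θ s = θ s ⊚ (B ⬝ a) := by
  simpa only [compPow_one] using interchange (hasArity_θ s) a

theorem theta_add (m n : ℕ) :
    theta A (m + n) = theta A m ⊚ (compPow B m ⬝ theta A n) ⊚ dbraid A m n := by
  induction m with
  | zero => rw [Nat.zero_add, theta, dbraid_zero_left, I_comp, comp_I, compPow, app_I]
  | succ m ih =>
    have e1 := interchange (hasArity_dbraid (A := A) 1 m) (theta A n)
    have e2 := B_dbraid_comp (A := A) 1 m n
    rw [compPow_one] at e2
    rw [Nat.add_right_comm, theta_succ, ih, B_comp, B_comp, theta_succ, ← comp_app, comp_assoc,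
      comp_assoc, e2, Nat.add_comm 1 m, comp_assoc, comp_assoc]
    rw [Nat.add_comm 1 m] at e1
    rw [← comp_assoc (dbraid A 1 m), ← e1, comp_assoc]
    rfl

theorem theta_add_braid (m n : ℕ) :
    theta A (m + n) = sig A Sgn.pos m n ⊚ (theta A n ⊚ (compPow B n ⬝ theta A m))
      ⊚ sig A Sgn.pos n m := by
  rw [theta_add, dbraid, ← comp_assoc (sig A Sgn.pos m n), ← comp_assoc (sig A Sgn.pos m n),
    ← sig_naturality_right (hasArity_theta n), comp_assoc (compPow B m ⬝ theta A n),
    ← sig_naturality (hasArity_theta m), ← comp_assoc (compPow B m ⬝ _) (theta A m),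
    interchange (hasArity_theta m)]
  simp only [comp_assoc]

/-- Naturality of the twist at `B : 2 → 1`. Without further wires this is `theta_four`; the
remaining wires enter through a double braid, itself natural at `B`. -/
theorem B_comp_theta (n : ℕ) : (B : A) ⊚ theta A (n + 1) = theta A (n + 2) ⊚ B := by
  have h4 : (B : A) ⊚ θ Sgn.pos = theta A 2 ⊚ B := by
    rw [theta_four, theta_succ, theta_one_eq, dbraid, sig_one, sigOne_one]
    have e : θ Sgn.pos ⊚ (C Sgn.pos : A) = C Sgn.pos ⊚ (B ⬝ θ Sgn.pos) := by
      simpa only [sigOne_one] using sigOne_naturality (hasArity_θ (A := A) Sgn.pos) Sgn.pos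
    have e2 : (B ⬝ θ Sgn.pos) ⊚ (C Sgn.pos : A) = C Sgn.pos ⊚ θ Sgn.pos := by
      simpa only [sig_one, sigOne_one, compPow_one] using
        sig_naturality_right (hasArity_θ (A := A) Sgn.pos) Sgn.pos 1
    rw [← comp_assoc (B ⬝ _), e2]
    simp only [comp_assoc]
  have h5 := dbraid_naturality (hasArity_two_one_B (A := A)) n
  rw [theta_succ, ← comp_assoc, h4, comp_assoc, ← comp_assoc B, B_comp_B, comp_assoc, h5,
    Nat.add_comm n 2, theta_add]
  simp only [compPow, comp_app, app_I, comp_assoc]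

theorem compPow_B_comp_theta (n : ℕ) :
    compPow (B : A) n ⊚ θ Sgn.pos = theta A (n + 1) ⊚ compPow B n := by
  induction n with
  | zero => rw [compPow, I_comp, comp_I, theta_one_eq]
  | succ n ih => rw [compPow, comp_assoc, ih, ← comp_assoc, B_comp_theta, comp_assoc]

theorem θ_comp_flip (s : Sgn) : (θ s : A) ⊚ θ s.flip = I := by
  rw [theta_two, ax_lambda]

/-- The argument of `sigOne_naturality` with `θ⁺` in the role of `C`: `(B a) ∘ Bⁿ ∘ θ⁺` is computed
in two ways and the tail is cancelled by `tuple`. -/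
theorem theta_naturality {m n : ℕ} {a : A} (h : HasArity m n a) :
    a ⊚ theta A n = theta A m ⊚ a := by
  have h1 : θ Sgn.pos ⊚ (B ⬝ (a ⊚ theta A n)) ⊚ dbraid A 1 n ⊚ compPow B n
      = θ Sgn.pos ⊚ (B ⬝ (theta A m ⊚ a)) ⊚ dbraid A 1 n ⊚ compPow B n := by
    have e := dbraid_naturality_right h 1
    rw [compPow_one] at e
    calc θ Sgn.pos ⊚ (B ⬝ (a ⊚ theta A n)) ⊚ dbraid A 1 n ⊚ compPow B n
        = (B ⬝ a) ⊚ compPow B n ⊚ θ Sgn.pos := by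
          rw [B_comp, comp_assoc, ← comp_assoc, ← θ_interchange, compPow_B_comp_theta, theta_succ]
          simp only [comp_assoc]
      _ = (bullet a ⊚ compPow B (m + 1)) ⊚ θ Sgn.pos := by rw [h, comp_assoc]
      _ = theta A (m + 1) ⊚ bullet a ⊚ compPow B (m + 1) := by
          rw [comp_assoc, compPow_B_comp_theta, theta_succ (m + 1), comp_assoc, comp_assoc,
            ← comp_assoc, bullet_comp_θ, ← comp_assoc, ← slide, comp_assoc]
          congr 1
          -- By naturality the double braid moves before the point, where one of its strands is
          -- missing.
          have hd : bullet a ⊚ dbraid A 1 (m + 1) = bullet a := by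
            have := dbraid_naturality (A := A) (m := 0) (n := 1) (a := bullet a) (hasArity_bullet _) (m + 1)
            rw [this, dbraid_zero_left, I_comp]
          rw [← comp_assoc, hd]
      _ = theta A (m + 1) ⊚ (B ⬝ a) ⊚ compPow B n := by rw [h]
      _ = _ := by
          rw [theta_succ, comp_assoc, comp_assoc, ← comp_assoc (dbraid _ _ _), ← e, B_comp]
          simp only [comp_assoc]
  have h2 : (B ⬝ (a ⊚ theta A n)) ⊚ dbraid A 1 n ⊚ compPow B n
      = (B ⬝ (theta A m ⊚ a)) ⊚ dbraid A 1 n ⊚ compPow B n := by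
    have := congrArg (θ Sgn.neg ⊚ ·) h1
    have e : (θ Sgn.neg : A) ⊚ θ Sgn.pos = I := θ_comp_flip Sgn.neg
    simpa only [← comp_assoc, e, I_comp] using this
  have hd : bullet (tuple A n) ⊚ dbraid A 1 n = bullet (tuple A n) := by
    rw [dbraid_naturality (hasArity_bullet _), dbraid_zero_left, I_comp]
  have key (x : A) : bullet (tuple A n) ⊚ (B ⬝ x) ⊚ dbraid A 1 n ⊚ compPow B n
      = x ⊚ bullet (tuple A n) ⊚ compPow B n := by
    rw [← comp_assoc, ← slide, comp_assoc, ← comp_assoc (bullet _), hd]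
  refine cancel_tuple (n := n) ?_
  rw [← key, ← key, h2]

end BalancedExtBCIAlgebra

namespace IsDuality

variable {A : Type u} [ExtBCIAlgebra A] {α β : A}

/-! ### Duality -/

theorem hasArity_unit (h : IsDuality α β) : HasArity 0 2 α := by
  simpa only [HasArity, compPow, comp_I] using h.arity_alpha

theorem hasArity_counit (h : IsDuality α β) : HasArity 2 0 β := by
  simpa only [HasArity, compPow, comp_I] using h.arity_beta

theorem hasArity_nestedUnit (h : IsDuality α β) (n : ℕ) : HasArity 0 (n + n) (nestedUnit α n) := by
  induction n with
  | zero => exact hasArity_I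
  | succ n ih =>
    have h1 := hasArity_add (hasArity_pow ih 1) 1
    rw [compPow_one, show 1 + (n + n) + 1 = n + 1 + (n + 1) by omega] at h1
    exact hasArity_comp h.hasArity_unit h1

theorem hasArity_nestedCounit (h : IsDuality α β) (n : ℕ) :
    HasArity (n + n) 0 (nestedCounit β n) := by
  induction n with
  | zero => exact hasArity_I
  | succ n ih =>
    have h1 := hasArity_add (hasArity_pow h.hasArity_counit n) n
    rw [show n + 2 + n = n + 1 + (n + 1) by omega] at h1
    exact hasArity_comp h1 ih

theorem nestedUnit_interchange (h : IsDuality α β) (n : ℕ) (a : A) :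
    nestedUnit α n ⊚ (compPow B (n + n) ⬝ a) = a ⊚ nestedUnit α n := by
  have := interchange (h.hasArity_nestedUnit n) a
  rw [← this, compPow, app_I]

theorem unit_interchange (h : IsDuality α β) (a : A) :
    α ⊚ (B ⬝ (B ⬝ a)) = a ⊚ α := by
  have := interchange h.hasArity_unit a
  simpa only [compPow, comp_app, app_I] using this.symm

/-- The outermost cup meets the innermost cap and is straightened by the snake equation of `α` and
`β`; the inner cups slide out by interchange and leave the case `n`. -/
theorem snake_left (h : IsDuality α β) (n : ℕ) :
    (compPow B n ⬝ nestedUnit α n) ⊚ nestedCounit β n = I := by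
  induction n with
  | zero => rw [compPow, app_I]; exact I_comp I
  | succ n ih =>
    have e1 : (B ⬝ (B ⬝ nestedUnit α n)) ⊚ β = β ⊚ nestedUnit α n := by
      simpa only [compPow, comp_app, app_I] using interchange h.hasArity_counit (nestedUnit α n)
    have e2 : (B ⬝ α) ⊚ β = I := by rw [h.duality_two, ax_lambda]
    have e3 : (B ⬝ (α ⊚ (B ⬝ nestedUnit α n))) ⊚ β = nestedUnit α n := by
      rw [B_comp, comp_assoc, e1, ← comp_assoc, e2, I_comp]
    rw [nestedUnit, nestedCounit, compPow, comp_app, ← compPow_B_app, ← comp_assoc,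
      ← compPow_B_comp, e3, ih]

theorem snake_right (h : IsDuality α β) (n : ℕ) :
    nestedUnit α n ⊚ (compPow B n ⬝ nestedCounit β n) = I := by
  induction n with
  | zero => rw [compPow, app_I]; exact I_comp I
  | succ n ih =>
    have e2 : α ⊚ (B ⬝ β) = I := by rw [h.duality_one, ax_lambda]
    rw [nestedUnit, nestedCounit, compPow, comp_app, compPow_B_comp, ← comp_app (compPow B n),
      ← compPow_add, B_comp, comp_assoc, ← comp_assoc (B ⬝ nestedUnit α n), ← B_comp,
      h.nestedUnit_interchange, B_comp, comp_assoc, ← comp_assoc, e2, I_comp, ← B_comp, ih,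
      ax_lambda]

/-- A strand can be pulled entirely across a cup, so its crossing with one leg is inverse to its
crossing with the other. -/
theorem comp_sig_of_arity_zero {k : ℕ} {a : A} (ha : HasArity 0 (k + k) a) (s : Sgn) (n : ℕ) :
    (compPow B n ⬝ a) ⊚ sig A s n k = a ⊚ (compPow B k ⬝ sig A s.flip k n) := by
  have e := sig_naturality_right ha s n
  rw [sig_add_right, sig, I_comp] at e
  have e' := congrArg (· ⊚ (compPow B k ⬝ sig A s.flip k n)) e
  simpa only [comp_assoc, ← compPow_B_comp, sig_comp_sig, compPow_B_I, comp_I] using e'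

/-- Each of the two crossings is carried across both cups `α` and `α_n`; its sign is reversed twice,
so it reappears positive on the other legs. -/
theorem nestedUnit_dbraid (h : IsDuality α β) (n : ℕ) :
    nestedUnit α (n + 1) ⊚ dbraid A 1 n
      = nestedUnit α (n + 1) ⊚ (compPow B (n + 1) ⬝ dbraid A n 1) := by
  have hn := h.hasArity_nestedUnit n
  have h1 : HasArity 0 (1 + 1) α := h.hasArity_unit
  have e1 := comp_sig_of_arity_zero hn Sgn.pos 1
  have e2 := comp_sig_of_arity_zero h1 Sgn.neg n
  have e3 := comp_sig_of_arity_zero h1 Sgn.pos n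
  have e4 := comp_sig_of_arity_zero hn Sgn.neg 1
  simp only [Sgn.flip] at e1 e2 e3 e4
  -- The two cups are created in either order, so that each in turn can be the one a crossing slides
  -- over.
  have e5 : α ⊚ nestedUnit α n = nestedUnit α n ⊚ (compPow B n ⬝ (compPow B n ⬝ α)) := by
    rw [← comp_app, ← compPow_add, h.nestedUnit_interchange]
  have e6 := interchange (hasArity_sig (A := A) Sgn.pos n 1) (sig A Sgn.pos 1 n)
  have e7 : nestedUnit α n ⊚ α = α ⊚ (B ⬝ (B ⬝ nestedUnit α n)) := (h.unit_interchange _).symm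
  simp only [compPow_one] at e1 e2 e3 e4
  calc nestedUnit α (n + 1) ⊚ dbraid A 1 n
      = α ⊚ ((B ⬝ nestedUnit α n) ⊚ sig A Sgn.pos 1 n) ⊚ sig A Sgn.pos n 1 := by
        rw [nestedUnit, dbraid]; simp only [comp_assoc]
    _ = nestedUnit α n ⊚ (compPow B n ⬝ ((compPow B n ⬝ α) ⊚ sig A Sgn.neg n 1))
          ⊚ sig A Sgn.pos n 1 := by
        rw [e1, comp_assoc, ← comp_assoc, e5, compPow_B_comp]; simp only [comp_assoc]
    _ = (nestedUnit α n ⊚ (compPow B n ⬝ α)) ⊚ (compPow B (n + 1) ⬝ sig A Sgn.pos 1 n)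
          ⊚ sig A Sgn.pos n 1 := by
        rw [e2, compPow_B_comp, compPow_B_app, compPow, comp_app]; simp only [comp_assoc]
    _ = nestedUnit α n ⊚ ((compPow B n ⬝ α) ⊚ sig A Sgn.pos n 1)
          ⊚ (compPow B (1 + n) ⬝ sig A Sgn.pos 1 n) := by
        rw [e6, Nat.add_comm 1 n]; simp only [comp_assoc]
    _ = α ⊚ (B ⬝ ((B ⬝ nestedUnit α n) ⊚ sig A Sgn.neg 1 n))
          ⊚ (compPow B (1 + n) ⬝ sig A Sgn.pos 1 n) := by
        rw [e3, comp_assoc, ← comp_assoc (nestedUnit α n), e7, B_comp]; simp only [comp_assoc]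
    _ = _ := by
        rw [e4, B_comp, nestedUnit, dbraid, compPow_B_comp, Nat.add_comm 1 n, compPow, comp_app]
        simp only [comp_assoc, comp_app]

end IsDuality

/-! ### Sliding the twist across nested cups -/

namespace IsRibbonDuality

open BalancedExtBCIAlgebra

variable {A : Type u} [BalancedExtBCIAlgebra A] {α β : A}

/-- In `θ_{n+1} = θ⁺ ∘ (B θ_n) ∘ dbraid 1 n` each factor passes to the other legs: the first by the
axiom on `α`, the second by induction, the third by `nestedUnit_dbraid`. -/
theorem nestedUnit_comp_theta (h : IsRibbonDuality α β) (n : ℕ) :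
    nestedUnit α n ⊚ theta A n = nestedUnit α n ⊚ (compPow B n ⬝ theta A n) := by
  induction n with
  | zero => rw [compPow, app_I]
  | succ n ih =>
    have hd := h.toIsDuality
    have e1 : nestedUnit α (n + 1) ⊚ θ Sgn.pos ⊚ (B ⬝ theta A n)
        = nestedUnit α (n + 1)
          ⊚ (compPow B (n + 1) ⬝ ((compPow B n ⬝ θ Sgn.pos) ⊚ theta A n)) := by
      calc nestedUnit α (n + 1) ⊚ θ Sgn.pos ⊚ (B ⬝ theta A n)
          = α ⊚ ((B ⬝ nestedUnit α n) ⊚ θ Sgn.pos) ⊚ (B ⬝ theta A n) := by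
            rw [nestedUnit]; simp only [comp_assoc]
        _ = α ⊚ (B ⬝ (θ Sgn.pos ⊚ nestedUnit α n ⊚ theta A n)) := by
            rw [θ_interchange, comp_assoc, ← comp_assoc, h.duality_theta, B_comp, B_comp]
            simp only [comp_assoc]
        _ = _ := by
            rw [ih, ← comp_assoc (θ Sgn.pos), ← hd.nestedUnit_interchange, compPow_add, comp_app,
              comp_assoc, ← compPow_B_comp, B_comp, nestedUnit, compPow, comp_app, comp_assoc]
    have e2 := interchange (hasArity_dbraid (A := A) 1 n)
      ((compPow B n ⬝ θ Sgn.pos) ⊚ theta A n)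
    rw [Nat.add_comm 1 n] at e2
    have e3 := interchange (hasArity_theta (A := A) n) (θ Sgn.pos)
    have e4 := theta_add (A := A) n 1
    rw [theta_one_eq] at e4
    have e5 : ((compPow B n ⬝ θ Sgn.pos) ⊚ theta A n) ⊚ dbraid A n 1 = theta A (n + 1) := by
      rw [e3, e4, comp_assoc]
    -- The factors arrive in reverse order; naturality of the double braid restores the order of
    -- `theta_add`.
    have e6 : dbraid A n 1 ⊚ (compPow B n ⬝ θ Sgn.pos) ⊚ theta A n = theta A (n + 1) := by
      rw [← e5, comp_assoc, dbraid_naturality (hasArity_theta n), ← comp_assoc (compPow B n ⬝ _),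
        dbraid_naturality_right (hasArity_θ _), comp_assoc]
    rw [theta_succ, ← comp_assoc (θ _), ← comp_assoc, e1, comp_assoc, e2, ← comp_assoc,
      hd.nestedUnit_dbraid, comp_assoc, ← compPow_B_comp, e6, theta_succ]
    simp only [comp_assoc]

end IsRibbonDuality

/-! ### The inverse of the twist -/

namespace BalancedExtBCIAlgebra

variable {A : Type u} [BalancedExtBCIAlgebra A]

/-- The inverse of `θ_m`. -/
def thetaInv (A : Type u) [BalancedExtBCIAlgebra A] : ℕ → A
  | 0 => I
  | m + 1 => sig A Sgn.neg 1 m ⊚ sig A Sgn.neg m 1 ⊚ (B ⬝ thetaInv A m) ⊚ θ Sgn.neg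

theorem thetaInv_one : thetaInv A 1 = θ Sgn.neg := by
  simp only [thetaInv, sig, sigOne, ax_lambda, I_comp]

theorem hasArity_thetaInv (n : ℕ) : HasArity n n (thetaInv A n) := by
  induction n with
  | zero => exact hasArity_I
  | succ n ih =>
    have h1 := hasArity_add (hasArity_θ (A := A) Sgn.neg) n
    have h2 := hasArity_sig (A := A) Sgn.neg 1 n
    have h3 := hasArity_sig (A := A) Sgn.neg n 1
    rw [Nat.add_comm] at h1 h2
    rw [Nat.add_comm 1 n] at h3
    exact hasArity_comp h2 (hasArity_comp h3 (hasArity_comp (hasArity_B ih) h1))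

theorem theta_comp_thetaInv (n : ℕ) : theta A n ⊚ thetaInv A n = I := by
  induction n with
  | zero => exact I_comp I
  | succ n ih =>
    have e1 : sig A Sgn.pos n 1 ⊚ sig A Sgn.neg 1 n = I := sig_comp_sig Sgn.pos n 1
    have e2 : sig A Sgn.pos 1 n ⊚ sig A Sgn.neg n 1 = I := sig_comp_sig Sgn.pos 1 n
    have e3 : (θ Sgn.pos : A) ⊚ θ Sgn.neg = I := θ_comp_flip Sgn.pos
    rw [theta_succ, thetaInv, dbraid]
    simp only [comp_assoc]
    rw [← comp_assoc (sig A Sgn.pos n 1), e1, I_comp, ← comp_assoc (sig A Sgn.pos 1 n), e2, I_comp,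
      ← comp_assoc (B ⬝ _), ← B_comp, ih, ax_lambda, I_comp, e3]

theorem thetaInv_comp_theta (n : ℕ) : thetaInv A n ⊚ theta A n = I := by
  induction n with
  | zero => exact I_comp I
  | succ n ih =>
    have e1 : sig A Sgn.neg 1 n ⊚ sig A Sgn.pos n 1 = I := sig_comp_sig Sgn.neg 1 n
    have e2 : sig A Sgn.neg n 1 ⊚ sig A Sgn.pos 1 n = I := sig_comp_sig Sgn.neg n 1
    have e3 : (θ Sgn.neg : A) ⊚ θ Sgn.pos = I := θ_comp_flip Sgn.neg
    rw [theta_succ, thetaInv, dbraid]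
    simp only [comp_assoc]
    rw [← comp_assoc (θ Sgn.neg), e3, I_comp, ← comp_assoc (B ⬝ _), ← B_comp, ih, ax_lambda, I_comp,
      ← comp_assoc (sig A Sgn.neg n 1), e2, I_comp, e1]

end BalancedExtBCIAlgebra

open BalancedExtBCIAlgebra

/-! ### The ribbon structure on the internal PRO -/

namespace InternalPRO

/-- The braiding of the internal PRO, generated by `C⁺` and `C⁻`. -/
def braidIso {A : Type u} [ExtBCIAlgebra A] (X Y : InternalPRO A) : X ⊗ Y ≅ Y ⊗ X where
  hom := ⟨sig A Sgn.pos X.wires Y.wires, hasArity_sig _ _ _⟩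
  inv := ⟨sig A Sgn.neg Y.wires X.wires, hasArity_sig _ _ _⟩
  hom_inv_id := hom_ext (sig_comp_sig Sgn.pos _ _)
  inv_hom_id := hom_ext (sig_comp_sig Sgn.neg _ _)

/-- The twist of the internal PRO, generated by `θ⁺` and `θ⁻`. -/
def twistIso {A : Type u} [BalancedExtBCIAlgebra A] (X : InternalPRO A) : X ≅ X where
  hom := ⟨theta A X.wires, hasArity_theta _⟩
  inv := ⟨thetaInv A X.wires, hasArity_thetaInv _⟩
  hom_inv_id := hom_ext (theta_comp_thetaInv _)
  inv_hom_id := hom_ext (thetaInv_comp_theta _)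

/-- The braided structure of the internal PRO. -/
@[reducible]
def braidedCategory (A : Type u) [ExtBCIAlgebra A] : BraidedCategory (InternalPRO A) where
  braiding := braidIso
  braiding_naturality_right X _ _ f := hom_ext (sig_naturality_right f.arity Sgn.pos X.wires)
  braiding_naturality_left f Z := hom_ext (sig_naturality f.arity Sgn.pos Z.wires)
  hexagon_forward X Y Z := hom_ext (by
    show (I : A) ⊚ sig A Sgn.pos X.wires (Y.wires + Z.wires) ⊚ I
      = sig A Sgn.pos X.wires Y.wires ⊚ I ⊚ (compPow B Y.wires ⬝ sig A Sgn.pos X.wires Z.wires)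
    rw [I_comp, I_comp, comp_I, sig_add_right])
  hexagon_reverse X Y Z := hom_ext (by
    show (I : A) ⊚ sig A Sgn.pos (X.wires + Y.wires) Z.wires ⊚ I
      = (compPow B X.wires ⬝ sig A Sgn.pos Y.wires Z.wires) ⊚ I ⊚ sig A Sgn.pos X.wires Z.wires
    rw [I_comp, I_comp, comp_I, sig_add_left])

/-- The balanced structure of the internal PRO. -/
@[reducible]
def balancedMonoidalCategory (A : Type u) [BalancedExtBCIAlgebra A] :
    BalancedMonoidalCategory (InternalPRO A) where
  toBraidedCategory := braidedCategory A
  twist := twistIso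
  twist_naturality f := hom_ext (theta_naturality f.arity)
  twist_tensor X Y := hom_ext (theta_add_braid X.wires Y.wires)

/-- Every object of the internal PRO is its own dual. -/
@[reducible]
def exactPairing {A : Type u} [ExtBCIAlgebra A] {α β : A} (h : IsDuality α β)
    (X : InternalPRO A) : ExactPairing X X where
  coevaluation' := ⟨nestedUnit α X.wires, h.hasArity_nestedUnit _⟩
  evaluation' := ⟨nestedCounit β X.wires, h.hasArity_nestedCounit _⟩
  coevaluation_evaluation' := hom_ext (by
    show (compPow B X.wires ⬝ nestedUnit α X.wires) ⊚ I ⊚ nestedCounit β X.wires = I ⊚ I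
    rw [I_comp, I_comp, h.snake_left])
  evaluation_coevaluation' := hom_ext (by
    show nestedUnit α X.wires ⊚ I ⊚ (compPow B X.wires ⬝ nestedCounit β X.wires) = I ⊚ I
    rw [I_comp, I_comp, h.snake_right])

/-- The rigid structure of the internal PRO. -/
@[reducible]
def rightRigidCategory {A : Type u} [ExtBCIAlgebra A] {α β : A} (h : IsDuality α β) :
    RightRigidCategory (InternalPRO A) where
  rightDual X := { rightDual := X, exact := exactPairing h X }

/-- The ribbon structure of the internal PRO. -/
@[reducible]
def ribbonCategory {A : Type u} [BalancedExtBCIAlgebra A] {α β : A} (h : IsRibbonDuality α β) :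
    RibbonCategory (InternalPRO A) where
  toBalancedMonoidalCategory := balancedMonoidalCategory A
  toRightRigidCategory := rightRigidCategory h.toIsDuality
  twist_dual X := hom_ext (by
    show (I : A) ⊚ (compPow B X.wires ⬝ nestedUnit α X.wires)
      ⊚ (compPow B X.wires ⬝ theta A X.wires) ⊚ I ⊚ nestedCounit β X.wires ⊚ I = theta A X.wires
    -- Once moved to the outer leg of the cup, the twist commutes with the cap and a bare snake
    -- remains.
    have e := interchange (h.toIsDuality.hasArity_nestedCounit X.wires) (theta A X.wires)
    rw [compPow_add, comp_app, compPow, app_I] at e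
    rw [I_comp, I_comp, comp_I, ← comp_assoc, ← compPow_B_comp, h.nestedUnit_comp_theta,
      compPow_B_comp, comp_assoc, e, ← comp_assoc, h.toIsDuality.snake_left, I_comp])

end InternalPRO

theorem mainTheorem6 (A : Type u) [BalancedExtBCIAlgebra A] (α β : A)
    (h : IsRibbonDuality α β) :
    ∃ R : RibbonCategory (InternalPRO A),
      -- the braid is generated by `C⁺`, `C⁻`
      (∀ X Y : InternalPRO A, (R.braiding X Y).hom.val = sigma A X.wires Y.wires) ∧
      (R.braiding ⟨1⟩ ⟨1⟩).hom.val = C Sgn.pos ∧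
      (R.braiding ⟨1⟩ ⟨1⟩).inv.val = C Sgn.neg ∧
      -- the twist is generated by `θ⁺`, `θ⁻`
      (∀ X : InternalPRO A, (R.twist X).hom.val = theta A X.wires) ∧
      (R.twist ⟨1⟩).hom.val = BalancedExtBCIAlgebra.θ Sgn.pos ∧
      (R.twist ⟨1⟩).inv.val = BalancedExtBCIAlgebra.θ Sgn.neg ∧
      -- every object is its own dual, and the duality is generated by `α`, `β`
      (∀ X : InternalPRO A, (Xᘁ : InternalPRO A) = X) ∧
      (∀ X : InternalPRO A, (η_ X Xᘁ).val = nestedUnit α X.wires) ∧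
      (∀ X : InternalPRO A, (ε_ X Xᘁ).val = nestedCounit β X.wires) ∧
      (η_ (⟨1⟩ : InternalPRO A) (⟨1⟩ : InternalPRO A)ᘁ).val = α ∧
      (ε_ (⟨1⟩ : InternalPRO A) (⟨1⟩ : InternalPRO A)ᘁ).val = β := by
  have hC (s : Sgn) : sig A s 1 1 = C s := by rw [sig_one, sigOne_one]
  have hα : nestedUnit α 1 = α := by rw [nestedUnit, nestedUnit, ax_lambda, comp_I]
  have hβ : nestedCounit β 1 = β := by rw [nestedCounit, nestedCounit, compPow, app_I, comp_I]
  exact ⟨InternalPRO.ribbonCategory h, fun X Y => (sigma_eq X.wires Y.wires).symm, hC _, hC _,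
    fun _ => rfl, theta_one_eq, thetaInv_one, fun _ => rfl, fun _ => rfl, fun _ => rfl, hα, hβ⟩
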